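/- Let $f:\mathbb{R}^n\to\mathbb{R}^n$ be a continuous vector field for which every initial value problem $x'=f(x)$, $x(0)=x_0$, has a unique local solution. Write $\varphi(\cdot,x)$ for the solution starting at $x$ and $I_x\ni 0$ for its maximal interval of existence. For $S\subseteq\mathbb{R}^n$ put $$\mathrm{In}_f(S)=\{x\in\mathbb{R}^n \mid \exists\,\varepsilon\in I_x\cap(0,\infty).\ \forall t\in(0,\varepsilon).\ \varphi(t,x)\in S\},$$ $$\mathrm{Exit}_f(S)=\{x\in S \mid \forall\, t\in I_x\cap(0,\infty).\ \exists s\in(0,t).\ \varphi(s,x)\notin S\}.$$ A set $S\subseteq\mathbb{R}^n$ is semi-analytic if every $a\in\mathbb{R}^n$ has an open neighbourhood $U$ such that $S\cap U$ is a finite union of sets, each described within $U$ by finitely many conditions $p<0$ and $q=0$ with $p,q$ real analytic on $U$. Let ${}^c$ denote the complement in $\mathbb{R}^n$. 1. If $f$ is real analytic on $\mathbb{R}^n$ and $S_1,S_2\subseteq\mathbb{R}^n$ are semi-analytic, then $$\mathrm{Exit}_f(S_1\cup S_2)=\bigl(\mathrm{Exit}_f(S_1)\cap \mathrm{In}_f(S_2)^c\bigr)\cup\bigl(\mathrm{In}_f(S_1)^c\cap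 \mathrm{Exit}_f(S_2)\bigr).$$ 2. For every $f$ as in the first sentence and arbitrary sets $S_1,S_2\subseteq\mathbb{R}^n$, $$\mathrm{Exit}_f(S_1\cup S_2)\subseteq\bigl(\mathrm{Exit}_f(S_1)\cap \mathrm{In}_f(S_2)^c\bigr)\cup\bigl(\mathrm{In}_f(S_1)^c\cap \mathrm{Exit}_f(S_2)\bigr).$$ 3. The reverse inclusion in 2 fails in general: already for the system $x'=1$ on $\mathbb{R}$ there are sets $S_1,S_2\subseteq\mathbb{R}$ for which it does not hold. -/

import Mathlib

/-- `γ` solves the initial value problem `x' = f(x)`, `x(0) = x` on the open interval `(a, b) ∋ 0`. -/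
def IsSolution {E : Type*} [NormedAddCommGroup E] [NormedSpace ℝ E]
    (f : E → E) (x : E) (a b : ℝ) (γ : ℝ → E) : Prop :=
  a < 0 ∧ 0 < b ∧ γ 0 = x ∧ ∀ t ∈ Set.Ioo a b, HasDerivAt γ (f (γ t)) t

/-- Every initial value problem for `x' = f(x)` has a local solution, and solutions are unique:
two solutions with the same initial value agree on every common interval of definition. -/
def HasUniqueSolutions {E : Type*} [NormedAddCommGroup E] [NormedSpace ℝ E] (f : E → E) : Prop :=
  ∀ x : E, (∃ a b γ, IsSolution f x a b γ) ∧
    ∀ a b γ₁ γ₂, IsSolution f x a b γ₁ → IsSolution f x a b γ₂ → Set.EqOn γ₁ γ₂ (Set.Ioo a b)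

/-- The maximal interval of existence `I_x`: the union of all open intervals around `0` on which
the initial value problem has a solution. -/
def maxInterval {E : Type*} [NormedAddCommGroup E] [NormedSpace ℝ E] (f : E → E) (x : E) : Set ℝ :=
  {t | ∃ γ : ℝ → E, ∃ a b, t ∈ Set.Ioo a b ∧ IsSolution f x a b γ}

open Classical in
/-- The local flow `φ(t, x)`: the value at time `t` of a solution starting at `x`. By uniqueness of
solutions it does not depend on the solution chosen. It is meaningful for `t ∈ maxInterval f x`;
outside this interval it takes the irrelevant value `x`. -/
noncomputable def flow {E : Type*} [NormedAddCommGroup E] [NormedSpace ℝ E]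
    (f : E → E) (t : ℝ) (x : E) : E :=
  if h : t ∈ maxInterval f x then h.choose t else x

/-- `In_f(S)`: the points from which the flow stays in `S` during some interval `(0, ε)`,
where `ε > 0` ranges over the maximal interval of existence. -/
def inSet {E : Type*} [NormedAddCommGroup E] [NormedSpace ℝ E] (f : E → E) (S : Set E) : Set E :=
  {x | ∃ ε ∈ maxInterval f x, 0 < ε ∧ ∀ t ∈ Set.Ioo 0 ε, flow f t x ∈ S}

/-- `Exit_f(S)`: the points of `S` from which the flow leaves `S` immediately; here `t > 0` ranges
over the maximal interval of existence. -/
def exitSet {E : Type*} [NormedAddCommGroup E] [NormedSpace ℝ E] (f : E → E) (S : Set E) : Set E :=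
  {x | x ∈ S ∧ ∀ t ∈ maxInterval f x, 0 < t → ∃ s ∈ Set.Ioo 0 t, flow f s x ∉ S}

/-- `S` is semi-analytic: every point `a` of the ambient space (not only of `S`) has an open
neighbourhood `U` on which `S` is a finite union of sets, each described by finitely many
conditions `p < 0` and `q = 0` with `p`, `q` real analytic on `U`. -/
def IsSemianalytic {E : Type*} [NormedAddCommGroup E] [NormedSpace ℝ E] (S : Set E) : Prop :=
  ∀ a : E, ∃ U : Set E, IsOpen U ∧ a ∈ U ∧
    ∃ C : Finset (Finset (E → ℝ) × Finset (E → ℝ)),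
      (∀ c ∈ C, (∀ p ∈ c.1, AnalyticOnNhd ℝ p U) ∧ (∀ q ∈ c.2, AnalyticOnNhd ℝ q U)) ∧
      ∀ y ∈ U, (y ∈ S ↔ ∃ c ∈ C, (∀ p ∈ c.1, p y < 0) ∧ (∀ q ∈ c.2, q y = 0))

/-! In terms of the filter `𝓝[>] 0`, a point is in `inSet f S` when its orbit is eventually in `S`,
and in `exitSet f S` when it lies in `S` and its orbit is frequently outside. The inclusion says
that an orbit frequently outside both sets is frequently outside each. The converse fails if the
orbit alternates between the sets, so the equality needs orbits that do not oscillate in and out of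
a semi-analytic set.

This reduces to `p (γ t)` having constant sign for small `t > 0`. Its successive derivatives are `h
k = (L_f^k p) ∘ γ`, with `L_f` the derivative along `f`, and Cauchy estimates give `|h k| ≤ A * C ^
k * k!` near `0`. If some `h k 0 ≠ 0`, repeated integration fixes the sign; otherwise Taylor gives
`|h 0 t| ≤ A * (C * t) ^ d` for every `d`, so `h 0` vanishes. Analyticity of `γ` itself is never
needed. -/

open Filter Topology Set

open scoped NNReal ENNReal

/-! ### Cauchy estimates for analytic maps -/

section DerivativeBounds

variable {E F : Type*} [NormedAddCommGroup E] [NormedSpace ℝ E]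
  [NormedAddCommGroup F] [NormedSpace ℝ F]

/-- The coefficients of the re-expansions of a power series at nearby points grow at most
geometrically, uniformly in the point. -/
theorem FormalMultilinearSeries.exists_norm_changeOrigin_le (p : FormalMultilinearSeries ℝ E F)
    {r r' : ℝ≥0} (hr' : 0 < r') (h : (r + r' : ℝ≥0∞) < p.radius) :
    ∃ M : ℝ, 0 ≤ M ∧ ∀ y : E, ‖y‖₊ ≤ r → ∀ k, ‖p.changeOrigin y k‖ ≤ M * ((r' : ℝ)⁻¹) ^ k := by
  have hs := p.changeOriginSeries_summable_aux₁ h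
  -- `M` is the whole convergent sum; the slice of fixed `k` already dominates `‖p.changeOrigin y k‖
  -- * r' ^ k`.
  refine ⟨_, NNReal.coe_nonneg (∑' s : Σ k l : ℕ, { s : Finset (Fin (k + l)) // s.card = l },
      ‖p (s.1 + s.2.1)‖₊ * r ^ s.2.1 * r' ^ s.1), fun y hy k => ?_⟩
  have hy' : (‖y‖₊ : ℝ≥0∞) < p.radius :=
    lt_of_le_of_lt (by exact_mod_cast hy) (lt_of_le_of_lt le_self_add h)
  have hr : (r : ℝ≥0∞) < p.radius := lt_of_le_of_lt le_self_add h
  have h1 := p.nnnorm_changeOrigin_le k hy'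
  have h2 : ∑' s : Σ l : ℕ, { s : Finset (Fin (k + l)) // s.card = l },
      ‖p (k + s.1)‖₊ * ‖y‖₊ ^ s.1 ≤
      ∑' s : Σ l : ℕ, { s : Finset (Fin (k + l)) // s.card = l }, ‖p (k + s.1)‖₊ * r ^ s.1 :=
    (p.changeOriginSeries_summable_aux₂ hy' k).tsum_le_tsum (fun s => by gcongr)
      (p.changeOriginSeries_summable_aux₂ hr k)
  have h3 := NNReal.tsum_comp_le_tsum_of_inj hs (sigma_mk_injective (i := k))
  simp only at h3
  rw [NNReal.tsum_mul_right] at h3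
  have h4 : ‖p.changeOrigin y k‖₊ * r' ^ k ≤ _ :=
    (mul_le_mul_left (h1.trans h2) _).trans h3
  have h5 := NNReal.coe_le_coe.2 h4
  rw [NNReal.coe_mul, NNReal.coe_pow, coe_nnnorm] at h5
  rw [inv_pow, ← div_eq_mul_inv, le_div_iff₀ (by positivity)]
  exact h5

/-- Cauchy-type estimates: near a point of analyticity the iterated derivatives of order `m` are
bounded by `M * R ^ m * m!`, uniformly. -/
theorem AnalyticAt.eventually_norm_iteratedFDeriv_le [CompleteSpace F] {f : E → F} {x : E}
    (hf : AnalyticAt ℝ f x) :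
    ∃ M R : ℝ, 0 ≤ M ∧ 0 < R ∧
      ∀ᶠ y in 𝓝 x, ∀ m : ℕ, ‖iteratedFDeriv ℝ m f y‖ ≤ M * R ^ m * m.factorial := by
  obtain ⟨p, ρ, hp⟩ := hf
  obtain ⟨r, hr0, hr⟩ := ENNReal.lt_iff_exists_nnreal_btwn.1 hp.r_pos
  have hr0' : 0 < r := by exact_mod_cast hr0
  have hrad : ((r / 2 : ℝ≥0) + (r / 2 : ℝ≥0) : ℝ≥0∞) < p.radius := by
    rw [← ENNReal.coe_add, add_halves]
    exact hr.trans_le hp.r_le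
  obtain ⟨M, hM, hb⟩ := p.exists_norm_changeOrigin_le (half_pos hr0') hrad
  refine ⟨M, ((r / 2 : ℝ≥0) : ℝ)⁻¹, hM, by positivity, ?_⟩
  filter_upwards [Metric.ball_mem_nhds x (show (0 : ℝ) < (r / 2 : ℝ≥0) by positivity)] with y hy m
  have hy1 : ‖y - x‖₊ < r / 2 := by
    rw [← NNReal.coe_lt_coe, coe_nnnorm, ← dist_eq_norm]; exact hy
  have hy2 : (‖y - x‖₊ : ℝ≥0∞) < ρ :=
    lt_trans (by exact_mod_cast hy1.trans (half_lt_self hr0')) hr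
  have hq := hp.changeOrigin hy2
  rw [add_sub_cancel] at hq
  refine ContinuousMultilinearMap.opNorm_le_bound (by positivity) fun v => ?_
  -- The derivative symmetrizes the `m`-th coefficient over all permutations, whence the factor
  -- `m!`.
  rw [hq.iteratedFDeriv_eq_sum_of_completeSpace v]
  refine (norm_sum_le _ _).trans ?_
  have : ∀ σ ∈ (Finset.univ : Finset (Equiv.Perm (Fin m))),
      ‖p.changeOrigin (y - x) m fun i => v (σ i)‖ ≤
        M * (((r / 2 : ℝ≥0) : ℝ)⁻¹) ^ m * ∏ i, ‖v i‖ := by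
    intro σ _
    refine (ContinuousMultilinearMap.le_opNorm _ _).trans ?_
    rw [Equiv.prod_comp σ (fun i => ‖v i‖)]
    gcongr
    exact hb _ hy1.le m
  refine (Finset.sum_le_card_nsmul _ _ _ this).trans (le_of_eq ?_)
  rw [Finset.card_univ, Fintype.card_perm, Fintype.card_fin, nsmul_eq_mul]
  ring

/-- The first two factors make `(i+1)⋯(i+j)`; raising each of these by `k` completes `(i+k)!` to
`(i+j+k)!`. -/
theorem Nat.choose_mul_factorial_mul_factorial_le (i j k : ℕ) :
    (i + j).choose i * j.factorial * (i + k).factorial ≤ (i + j + k).factorial := by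
  have h1 : (i + j).choose i * j.factorial = (i + 1).ascFactorial j := by
    have h2 := Nat.add_choose_mul_factorial_mul_factorial i j
    have h3 := Nat.factorial_mul_ascFactorial i j
    refine Nat.eq_of_mul_eq_mul_left i.factorial_pos ?_
    rw [h3, ← h2, Nat.choose_symm_add]; ring
  rw [h1, mul_comm]
  calc (i + k).factorial * (i + 1).ascFactorial j
      ≤ (i + k).factorial * (i + k + 1).ascFactorial j := by
        gcongr
        exact Nat.le_add_right i k
    _ = (i + j + k).factorial := by rw [Nat.factorial_mul_ascFactorial]; congr 1; omega

end DerivativeBounds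

/-! ### Growth of iterated derivatives along a vector field -/

section LieDerivative

variable {E : Type*} [NormedAddCommGroup E] [NormedSpace ℝ E]

/-- The derivative of `u` along the vector field `f`. -/
noncomputable def vectorFieldDeriv (f : E → E) (u : E → ℝ) : E → ℝ := fun y => fderiv ℝ u y (f y)

theorem AnalyticOnNhd.vectorFieldDeriv {f : E → E} {u : E → ℝ} {V : Set E}
    (hf : AnalyticOnNhd ℝ f V) (hu : AnalyticOnNhd ℝ u V) :
    AnalyticOnNhd ℝ (vectorFieldDeriv f u) V :=
  fun y hy => ((ContinuousLinearMap.id ℝ (E →L[ℝ] ℝ)).analyticAt_bilinear _).comp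
    ((hu.fderiv y hy).prod (hf y hy))

/-- Leibniz rule: the extra derivative on `u` is absorbed by passing from `k` to `k + 1` in the
factorial. The rate `R / 2` for `f` leaves a geometric sum, bounded by `2` independently of `m`. -/
theorem norm_iteratedFDeriv_vectorFieldDeriv_le [CompleteSpace E] {f : E → E} {u : E → ℝ} {V : Set E} (hV : IsOpen V)
    (hf : AnalyticOnNhd ℝ f V) (hu : AnalyticOnNhd ℝ u V) {M R A : ℝ} {k : ℕ}
    (hM : 0 ≤ M) (hR : 0 < R) (hA : 0 ≤ A)
    (hfb : ∀ y ∈ V, ∀ m : ℕ, ‖iteratedFDeriv ℝ m f y‖ ≤ M * (R / 2) ^ m * m.factorial)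
    (hub : ∀ y ∈ V, ∀ m : ℕ, ‖iteratedFDeriv ℝ m u y‖ ≤ A * R ^ m * (m + k).factorial) :
    ∀ y ∈ V, ∀ m : ℕ, ‖iteratedFDeriv ℝ m (vectorFieldDeriv f u) y‖ ≤
      (A * (2 * M * R)) * R ^ m * (m + (k + 1)).factorial := by
  intro y hy m
  have hd : ContDiffOn ℝ m (fderiv ℝ u) V := fun z hz =>
    ((hu.fderiv z hz).contDiffAt).contDiffWithinAt
  have hf' : ContDiffOn ℝ m f V := fun z hz => ((hf z hz).contDiffAt).contDiffWithinAt
  have h := norm_iteratedFDerivWithin_clm_apply hd hf' hV.uniqueDiffOn hy le_rfl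
  rw [iteratedFDerivWithin_of_isOpen m hV hy] at h
  refine h.trans ?_
  have hterm : ∀ i ∈ Finset.range (m + 1),
      (m.choose i : ℝ) * ‖iteratedFDerivWithin ℝ i (fderiv ℝ u) V y‖ *
        ‖iteratedFDerivWithin ℝ (m - i) f V y‖ ≤
      A * M * R ^ (m + 1) * (m + (k + 1)).factorial * (1 / 2) ^ (m - i) := by
    intro i hi
    obtain ⟨j, rfl⟩ := Nat.exists_eq_add_of_le (Finset.mem_range_succ_iff.1 hi)
    rw [Nat.add_sub_cancel_left, iteratedFDerivWithin_of_isOpen i hV hy,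
      iteratedFDerivWithin_of_isOpen j hV hy, norm_iteratedFDeriv_fderiv]
    have hc : (((i + j).choose i * j.factorial * (i + (k + 1)).factorial : ℕ) : ℝ) ≤
        ((i + j + (k + 1)).factorial : ℕ) :=
      Nat.cast_le.2 (Nat.choose_mul_factorial_mul_factorial_le i j (k + 1))
    push_cast at hc
    have h1 := hub y hy (i + 1)
    rw [show i + 1 + k = i + (k + 1) by ring] at h1
    calc ((i + j).choose i : ℝ) * ‖iteratedFDeriv ℝ (i + 1) u y‖ * ‖iteratedFDeriv ℝ j f y‖
        ≤ (i + j).choose i * (A * R ^ (i + 1) * (i + (k + 1)).factorial) *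
          (M * (R / 2) ^ j * j.factorial) := by
          gcongr
          exact hfb y hy j
      _ = A * M * R ^ (i + j + 1) * ((i + j).choose i * j.factorial * (i + (k + 1)).factorial) *
          (1 / 2) ^ j := by
          rw [div_pow, one_div, inv_pow]; ring
      _ ≤ _ := by gcongr
  refine (Finset.sum_le_sum hterm).trans ?_
  rw [← Finset.mul_sum]
  have hgeo : ∑ i ∈ Finset.range (m + 1), ((1 : ℝ) / 2) ^ (m - i) ≤ 2 := by
    have := Finset.sum_range_reflect (fun i => ((1 : ℝ) / 2) ^ i) (m + 1)
    simp only [Nat.add_sub_cancel] at this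
    rw [this]
    exact sum_geometric_two_le _
  calc _ ≤ A * M * R ^ (m + 1) * (m + (k + 1)).factorial * 2 := by gcongr
    _ = _ := by ring

theorem norm_iteratedFDeriv_iterate_vectorFieldDeriv_le [CompleteSpace E] {f : E → E} {u : E → ℝ}
    {V : Set E} (hV : IsOpen V) (hf : AnalyticOnNhd ℝ f V) (hu : AnalyticOnNhd ℝ u V) {M R A : ℝ}
    (hM : 0 ≤ M) (hR : 0 < R) (hA : 0 ≤ A)
    (hfb : ∀ y ∈ V, ∀ m : ℕ, ‖iteratedFDeriv ℝ m f y‖ ≤ M * (R / 2) ^ m * m.factorial)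
    (hub : ∀ y ∈ V, ∀ m : ℕ, ‖iteratedFDeriv ℝ m u y‖ ≤ A * R ^ m * m.factorial) (k : ℕ) :
    AnalyticOnNhd ℝ ((vectorFieldDeriv f)^[k] u) V ∧
    ∀ y ∈ V, ∀ m : ℕ, ‖iteratedFDeriv ℝ m ((vectorFieldDeriv f)^[k] u) y‖ ≤
      (A * (2 * M * R) ^ k) * R ^ m * (m + k).factorial := by
  induction k with
  | zero => exact ⟨hu, by simpa using hub⟩
  | succ k ih =>
    rw [Function.iterate_succ_apply', pow_succ, ← mul_assoc]
    exact ⟨hf.vectorFieldDeriv ih.1, norm_iteratedFDeriv_vectorFieldDeriv_le hV hf ih.1 hM hR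
      (by positivity) hfb ih.2⟩

end LieDerivative

/-! ### One-sided sign of functions with factorially bounded derivatives -/

section Sign

/-- To the right of `0` and close to it, `h` is negative, or zero, or positive throughout. -/
def HasConstantSignRight (h : ℝ → ℝ) : Prop :=
  (∀ᶠ t in 𝓝[>] 0, h t < 0) ∨ (∀ᶠ t in 𝓝[>] 0, h t = 0) ∨ (∀ᶠ t in 𝓝[>] 0, 0 < h t)

theorem HasConstantSignRight.of_ne_zero {h : ℝ → ℝ} (hc : ContinuousAt h 0) (h0 : h 0 ≠ 0) :
    HasConstantSignRight h := by
  rcases lt_or_gt_of_ne h0 with hlt | hgt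
  · exact Or.inl ((hc.eventually_lt continuousAt_const hlt).filter_mono nhdsWithin_le_nhds)
  · exact Or.inr (Or.inr ((continuousAt_const.eventually_lt hc hgt).filter_mono
      nhdsWithin_le_nhds))

theorem eventually_pos_of_deriv_pos {g g' : ℝ → ℝ} (hg : ∀ᶠ t in 𝓝 0, HasDerivAt g (g' t) t)
    (h0 : g 0 = 0) (hpos : ∀ᶠ t in 𝓝[>] 0, 0 < g' t) : ∀ᶠ t in 𝓝[>] 0, 0 < g t := by
  obtain ⟨ε, hε, hε'⟩ := mem_nhdsGT_iff_exists_Ioo_subset.1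
    (hpos.and (hg.filter_mono nhdsWithin_le_nhds))
  have hc : ContinuousOn g (Ico 0 ε) := by
    intro t ht
    rcases ht.1.eq_or_lt with rfl | htp
    · exact hg.self_of_nhds.continuousAt.continuousWithinAt
    · exact (hε' ⟨htp, ht.2⟩).2.continuousAt.continuousWithinAt
  have hm : StrictMonoOn g (Ico 0 ε) := by
    refine strictMonoOn_of_deriv_pos (convex_Ico 0 ε) hc fun t ht => ?_
    rw [interior_Ico] at ht
    rw [(hε' ht).2.deriv]
    exact (hε' ht).1
  filter_upwards [Ioo_mem_nhdsGT hε] with t ht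
  rw [← h0]
  exact hm ⟨le_rfl, hε⟩ ⟨ht.1.le, ht.2⟩ ht.1

theorem HasConstantSignRight.of_deriv {g g' : ℝ → ℝ} (hg : ∀ᶠ t in 𝓝 0, HasDerivAt g (g' t) t)
    (hg' : HasConstantSignRight g') : HasConstantSignRight g := by
  by_cases h0 : g 0 = 0
  · rcases hg' with hneg | hz | hpos
    · left
      have := eventually_pos_of_deriv_pos (g := fun t => -g t) (g' := fun t => -g' t)
        (hg.mono fun t ht => ht.neg) (by simp [h0]) (by simpa using hneg)
      simpa using this
    · right; left
      obtain ⟨ε, hε, hε'⟩ := mem_nhdsGT_iff_exists_Ioo_subset.1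
        (hz.and (hg.filter_mono nhdsWithin_le_nhds))
      filter_upwards [Ioo_mem_nhdsGT hε] with t ht
      have hc : ContinuousOn g (Icc 0 t) := by
        intro s hs
        rcases hs.1.eq_or_lt with rfl | hsp
        · exact hg.self_of_nhds.continuousAt.continuousWithinAt
        · exact (hε' ⟨hsp, hs.2.trans_lt ht.2⟩).2.continuousAt.continuousWithinAt
      obtain ⟨c, hc, hc'⟩ := exists_hasDerivAt_eq_slope g g' ht.1 hc
        fun s hs => (hε' ⟨hs.1, hs.2.trans ht.2⟩).2
      rw [(hε' ⟨hc.1, hc.2.trans ht.2⟩).1, h0, sub_zero, sub_zero, eq_comm,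
        div_eq_zero_iff] at hc'
      exact hc'.resolve_right ht.1.ne'
    · exact Or.inr (Or.inr (eventually_pos_of_deriv_pos hg h0 hpos))
  · exact .of_ne_zero hg.self_of_nhds.continuousAt h0

theorem HasConstantSignRight.of_exists_ne_zero {h : ℕ → ℝ → ℝ}
    (hd : ∀ᶠ t in 𝓝 0, ∀ k, HasDerivAt (h k) (h (k + 1) t) t) (k : ℕ) (hk : h k 0 ≠ 0) :
    HasConstantSignRight (h 0) := by
  induction k generalizing h with
  | zero => exact .of_ne_zero (hd.self_of_nhds 0).continuousAt hk
  | succ k ih =>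
    exact .of_deriv (hd.mono fun t ht => ht 0)
      (ih (h := fun j => h (j + 1)) (hd.mono fun t ht j => ht (j + 1)) hk)

/-- Integrating the bound on `h (j + d)` from `0`, `d` times, with all initial values zero. -/
theorem abs_le_of_forall_deriv_eq_zero {h : ℕ → ℝ → ℝ} {δ A C : ℝ}
    (hd : ∀ t ∈ Ico 0 δ, ∀ k, HasDerivAt (h k) (h (k + 1) t) t) (h0 : ∀ k, h k 0 = 0)
    (hb : ∀ t ∈ Ico 0 δ, ∀ k, |h k t| ≤ A * C ^ k * k.factorial) (d : ℕ) :
    ∀ j, ∀ t ∈ Ico 0 δ,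
      |h j t| ≤ A * C ^ (j + d) * (j + d).factorial * (t ^ d / d.factorial) := by
  induction d with
  | zero => intro j t ht; simpa using hb t ht j
  | succ d ih =>
    intro j t ht
    have hsub : ∀ s ∈ Icc 0 t, s ∈ Ico 0 δ := fun s hs => ⟨hs.1, hs.2.trans_lt ht.2⟩
    set K := A * C ^ (j + (d + 1)) * (j + (d + 1)).factorial with hK
    refine image_norm_le_of_norm_deriv_right_le_deriv_boundary (f := h j) (f' := h (j + 1))
      (a := 0) (b := t) (B := fun s => K * (s ^ (d + 1) / (d + 1).factorial))
      (B' := fun s => K * (s ^ d / d.factorial))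
      (fun s hs => (hd s (hsub s hs) j).continuousAt.continuousWithinAt)
      (fun s hs => (hd s (hsub s (Ico_subset_Icc_self hs)) j).hasDerivWithinAt)
      (by simp [h0]) (fun s => ?_) (fun s hs => ?_) ⟨ht.1, le_rfl⟩
    · refine (((hasDerivAt_pow (d + 1) s).div_const ((d + 1).factorial : ℝ)).const_mul
        K).congr_deriv ?_
      rw [Nat.factorial_succ, Nat.add_sub_cancel]
      push_cast
      field_simp
    · have := ih (j + 1) s (hsub s (Ico_subset_Icc_self hs))
      rwa [show j + 1 + d = j + (d + 1) by ring] at this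

theorem eventually_eq_zero_of_forall_deriv_eq_zero {h : ℕ → ℝ → ℝ} {A C : ℝ} (hC : 0 ≤ C)
    (hd : ∀ᶠ t in 𝓝 0, ∀ k, HasDerivAt (h k) (h (k + 1) t) t) (h0 : ∀ k, h k 0 = 0)
    (hb : ∀ᶠ t in 𝓝 0, ∀ k, |h k t| ≤ A * C ^ k * k.factorial) :
    ∀ᶠ t in 𝓝[>] 0, h 0 t = 0 := by
  obtain ⟨δ, hδ, hδ'⟩ := Metric.eventually_nhds_iff_ball.1 (hd.and hb)
  have hsub : ∀ t ∈ Ico 0 δ, t ∈ Metric.ball (0 : ℝ) δ := fun t ht => by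
    rw [Metric.mem_ball, dist_zero_right, Real.norm_of_nonneg ht.1]; exact ht.2
  have hCt : ∀ᶠ t in 𝓝[>] (0 : ℝ), C * t < 1 :=
    ((continuous_const.mul continuous_id).continuousAt.eventually_lt continuousAt_const
      (by simp)).filter_mono nhdsWithin_le_nhds
  filter_upwards [Ioo_mem_nhdsGT hδ, hCt] with t ht htC
  -- For `j = 0` the factor `d!` of the bound cancels against the Taylor denominator.
  have hlim : Tendsto (fun d : ℕ => A * (C * t) ^ d) atTop (𝓝 0) := by
    simpa using (tendsto_pow_atTop_nhds_zero_of_lt_one (mul_nonneg hC ht.1.le) htC).const_mul A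
  have hle : |h 0 t| ≤ 0 := by
    refine ge_of_tendsto' hlim fun d => ?_
    have := abs_le_of_forall_deriv_eq_zero (fun t ht => (hδ' t (hsub t ht)).1) h0
      (fun t ht => (hδ' t (hsub t ht)).2) d 0 t ⟨ht.1.le, ht.2⟩
    refine this.trans (le_of_eq ?_)
    rw [zero_add, mul_pow]
    field_simp
  exact abs_eq_zero.1 (le_antisymm hle (abs_nonneg _))

theorem HasConstantSignRight.of_factorial_bound {h : ℕ → ℝ → ℝ} {A C : ℝ} (hC : 0 ≤ C)
    (hd : ∀ᶠ t in 𝓝 0, ∀ k, HasDerivAt (h k) (h (k + 1) t) t)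
    (hb : ∀ᶠ t in 𝓝 0, ∀ k, |h k t| ≤ A * C ^ k * k.factorial) :
    HasConstantSignRight (h 0) := by
  by_cases h0 : ∀ k, h k 0 = 0
  · exact Or.inr (Or.inl (eventually_eq_zero_of_forall_deriv_eq_zero hC hd h0 hb))
  · push Not at h0
    obtain ⟨k, hk⟩ := h0
    exact .of_exists_ne_zero hd k hk

end Sign

/-! ### Integral curves, the flow, and the exit set of a union -/

section Flow

variable {E : Type*} [NormedAddCommGroup E] [NormedSpace ℝ E]

/-- An analytic function has constant sign on an initial segment of each integral curve of an
analytic vector field. -/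
theorem hasConstantSignRight_comp_of_hasDerivAt [CompleteSpace E] {f : E → E} {p : E → ℝ} {x : E}
    (hf : AnalyticAt ℝ f x) (hp : AnalyticAt ℝ p x) {γ : ℝ → E} (h0 : γ 0 = x)
    (hγ : ∀ᶠ t in 𝓝 0, HasDerivAt γ (f (γ t)) t) : HasConstantSignRight fun t => p (γ t) := by
  obtain ⟨M, R₁, hM, hR₁, hfb⟩ := hf.eventually_norm_iteratedFDeriv_le
  obtain ⟨A, R₂, hA, hR₂, hpb⟩ := hp.eventually_norm_iteratedFDeriv_le
  obtain ⟨V, hV, hVo, hxV⟩ := eventually_nhds_iff.1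
    ((hfb.and hpb).and (hf.eventually_analyticAt.and hp.eventually_analyticAt))
  -- Chosen so that `R₁ ≤ R / 2` and `R₂ ≤ R`.
  set R := 2 * R₁ + R₂ with hR
  have hR0 : 0 < R := by positivity
  have key := norm_iteratedFDeriv_iterate_vectorFieldDeriv_le (f := f) (u := p) (R := R) hVo
    (fun y hy => (hV y hy).2.1) (fun y hy => (hV y hy).2.2) hM hR0 hA
    (fun y hy m => ((hV y hy).1.1 m).trans (by gcongr; linarith))
    (fun y hy m => ((hV y hy).1.2 m).trans (by gcongr; linarith))
  have hγV : ∀ᶠ t in 𝓝 0, γ t ∈ V :=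
    hγ.self_of_nhds.continuousAt.eventually_mem (hVo.mem_nhds (by rwa [h0]))
  refine HasConstantSignRight.of_factorial_bound
    (h := fun k t => (vectorFieldDeriv f)^[k] p (γ t)) (A := A) (C := 2 * M * R)
    (by positivity) ?_ ?_
  · filter_upwards [hγ, hγV] with t ht htV k
    have := ((key k).1 _ htV).differentiableAt.hasFDerivAt.comp_hasDerivAt t ht
    rw [Function.iterate_succ_apply']
    exact this
  · filter_upwards [hγV] with t htV k
    simpa using (key k).2 _ htV 0

/-- Membership in a semi-analytic set is constant on an initial segment of each integral curve of
an analytic vector field. -/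
theorem IsSemianalytic.eventually_mem_or_notMem [CompleteSpace E] {f : E → E} {S : Set E} {x : E}
    (hf : AnalyticAt ℝ f x) (hS : IsSemianalytic S) {γ : ℝ → E} (h0 : γ 0 = x)
    (hγ : ∀ᶠ t in 𝓝 0, HasDerivAt γ (f (γ t)) t) :
    (∀ᶠ t in 𝓝[>] 0, γ t ∈ S) ∨ (∀ᶠ t in 𝓝[>] 0, γ t ∉ S) := by
  obtain ⟨U, hU, hxU, C, hC, hSU⟩ := hS x
  have hsign : ∀ p : E → ℝ, AnalyticOnNhd ℝ p U → HasConstantSignRight fun t => p (γ t) :=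
    fun p hp => hasConstantSignRight_comp_of_hasDerivAt hf (hp x hxU) h0 hγ
  have hγU : ∀ᶠ t in 𝓝[>] 0, γ t ∈ U :=
    (hγ.self_of_nhds.continuousAt.eventually_mem (hU.mem_nhds (by rwa [h0]))).filter_mono
      nhdsWithin_le_nhds
  by_cases h : ∃ᶠ t in 𝓝[>] 0, γ t ∈ S
  · left
    have h1 : ∃ᶠ t in 𝓝[>] 0, ∃ c ∈ C,
        (∀ p ∈ c.1, p (γ t) < 0) ∧ (∀ q ∈ c.2, q (γ t) = 0) :=
      (h.and_eventually hγU).mono fun t ht => (hSU _ ht.2).1 ht.1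
    -- Finitely many pieces, so one is met frequently; constancy of sign then makes each of its
    -- conditions hold eventually.
    obtain ⟨c, hc, hfr⟩ := (Filter.frequently_exists_finset C).1 h1
    have h3 : ∀ p ∈ c.1, ∀ᶠ t in 𝓝[>] 0, p (γ t) < 0 := fun p hp => by
      rcases hsign p ((hC c hc).1 p hp) with hs | hs | hs
      · exact hs
      · obtain ⟨t, ht, ht'⟩ := (hfr.and_eventually hs).exists
        exact absurd ht' (ht.1 p hp).ne
      · obtain ⟨t, ht, ht'⟩ := (hfr.and_eventually hs).exists
        exact absurd ht' (ht.1 p hp).not_gt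
    have h4 : ∀ q ∈ c.2, ∀ᶠ t in 𝓝[>] 0, q (γ t) = 0 := fun q hq => by
      rcases hsign q ((hC c hc).2 q hq) with hs | hs | hs
      · obtain ⟨t, ht, ht'⟩ := (hfr.and_eventually hs).exists
        exact absurd (ht.2 q hq) ht'.ne
      · exact hs
      · obtain ⟨t, ht, ht'⟩ := (hfr.and_eventually hs).exists
        exact absurd (ht.2 q hq) ht'.ne'
    filter_upwards [hγU, (Filter.eventually_all_finset c.1).2 h3,
      (Filter.eventually_all_finset c.2).2 h4] with t ht ht1 ht2
    exact (hSU _ ht).2 ⟨c, hc, ht1, ht2⟩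
  · exact Or.inr (not_frequently.1 h)

theorem IsSolution.eventually_hasDerivAt {f : E → E} {x : E} {a b : ℝ} {γ : ℝ → E}
    (h : IsSolution f x a b γ) : ∀ᶠ t in 𝓝 0, HasDerivAt γ (f (γ t)) t :=
  mem_of_superset (Ioo_mem_nhds h.1 h.2.1) h.2.2.2

/-- Two integral curves of a `C¹` vector field which meet agree. -/
theorem eqOn_Ioo_of_contDiff {f : E → E} (hf : ContDiff ℝ 1 f) {a b t₀ : ℝ} {γ η : ℝ → E}
    (ht₀ : t₀ ∈ Ioo a b) (hγ : ∀ t ∈ Ioo a b, HasDerivAt γ (f (γ t)) t)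
    (hη : ∀ t ∈ Ioo a b, HasDerivAt η (f (η t)) t) (h : γ t₀ = η t₀) :
    EqOn γ η (Ioo a b) := by
  set s := {t | t ∈ Ioo a b ∧ γ t = η t} with hs
  suffices hsub : Ioo a b ⊆ s from fun t ht => (hsub ht).2
  -- The agreement set is open by local Lipschitz uniqueness and relatively closed by continuity.
  refine isPreconnected_Ioo.subset_of_closure_inter_subset ?_ ⟨t₀, ht₀, ht₀, h⟩ ?_
  · rw [isOpen_iff_mem_nhds]
    intro t ht
    have hmem := Ioo_mem_nhds ht.1.1 ht.1.2
    obtain ⟨K, W, hW, hK⟩ := (hf.contDiffAt (x := γ t)).exists_lipschitzOnWith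
    have heq : γ =ᶠ[𝓝 t] η := by
      refine ODE_solution_unique_of_eventually (v := fun _ => f) (s := fun _ => W) (K := K)
        (Eventually.of_forall fun _ => hK) ?_ ?_ ht.2
      · filter_upwards [hmem, (hγ t ht.1).continuousAt.eventually_mem hW] with r hr hr'
        exact ⟨hγ r hr, hr'⟩
      · filter_upwards [hmem, (hη t ht.1).continuousAt.eventually_mem (ht.2 ▸ hW)] with r hr hr'
        exact ⟨hη r hr, hr'⟩
    filter_upwards [heq, hmem] with r hr hr' using ⟨hr', hr⟩
  · rintro t ⟨htc, ht⟩
    refine ⟨ht, ?_⟩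
    have : (𝓝[s] t).NeBot := mem_closure_iff_nhdsWithin_neBot.1 htc
    refine tendsto_nhds_unique_of_eventuallyEq
      ((hγ t ht).continuousAt.continuousWithinAt (s := s))
      ((hη t ht).continuousAt.continuousWithinAt (s := s)) ?_
    exact eventually_mem_nhdsWithin.mono fun r hr => hr.2

theorem IsSolution.exists_of_contDiff [CompleteSpace E] {f : E → E} (hf : ContDiff ℝ 1 f) (x : E) :
    ∃ a b γ, IsSolution f x a b γ := by
  obtain ⟨γ, h0, ε, hε, h⟩ :=
    hf.contDiffAt.exists_forall_mem_closedBall_exists_eq_forall_mem_Ioo_hasDerivAt₀ (x₀ := x) 0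
  exact ⟨0 - ε, 0 + ε, γ, by linarith, by linarith, h0, h⟩

theorem IsSolution.mem_maxInterval {f : E → E} {x : E} {a b : ℝ} {γ : ℝ → E}
    (h : IsSolution f x a b γ) {t : ℝ} (ht : t ∈ Ioo a b) : t ∈ maxInterval f x :=
  ⟨γ, a, b, ht, h⟩

/-- The flow of a `C¹` vector field agrees with every solution. -/
theorem IsSolution.flow_eq {f : E → E} (hf : ContDiff ℝ 1 f) {x : E} {a b : ℝ} {γ : ℝ → E}
    (h : IsSolution f x a b γ) {t : ℝ} (ht : t ∈ Ioo a b) : flow f t x = γ t := by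
  have hmem := h.mem_maxInterval ht
  rw [flow, dif_pos hmem]
  obtain ⟨a', b', ht', h'⟩ := hmem.choose_spec
  refine eqOn_Ioo_of_contDiff hf (a := max a a') (b := min b b') (t₀ := 0)
    ⟨max_lt h.1 h'.1, lt_min h.2.1 h'.2.1⟩
    (fun s hs => h'.2.2.2 s ⟨(le_max_right _ _).trans_lt hs.1, hs.2.trans_le (min_le_right _ _)⟩)
    (fun s hs => h.2.2.2 s ⟨(le_max_left _ _).trans_lt hs.1, hs.2.trans_le (min_le_left _ _)⟩)
    (h'.2.2.1.trans h.2.2.1.symm) ⟨max_lt ht.1 ht'.1, lt_min ht.2 ht'.2⟩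

theorem mem_inSet_iff {f : E → E} {x : E} (hx : ∃ a b γ, IsSolution f x a b γ) {S : Set E} :
    x ∈ inSet f S ↔ ∀ᶠ t in 𝓝[>] 0, flow f t x ∈ S := by
  constructor
  · rintro ⟨ε, -, hε, h⟩
    filter_upwards [Ioo_mem_nhdsGT hε] with t ht using h t ht
  · intro h
    obtain ⟨a, b, γ, hγ⟩ := hx
    obtain ⟨ε, hε, hε'⟩ := mem_nhdsGT_iff_exists_Ioo_subset.1 h
    have hε : 0 < ε := hε
    have hb : 0 < b := hγ.2.1
    -- `ε` must itself be a time of existence; `b / 2` lies inside the open interval, while `b` need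
    -- not.
    refine ⟨min ε (b / 2), hγ.mem_maxInterval ⟨hγ.1.trans (by positivity),
      (min_le_right _ _).trans_lt (by linarith)⟩, by positivity, fun t ht => ?_⟩
    exact hε' ⟨ht.1, ht.2.trans_le (min_le_left _ _)⟩

theorem mem_exitSet_iff {f : E → E} {x : E} (hx : ∃ a b γ, IsSolution f x a b γ) {S : Set E} :
    x ∈ exitSet f S ↔ x ∈ S ∧ ∃ᶠ t in 𝓝[>] 0, flow f t x ∉ S := by
  have h : x ∈ exitSet f S ↔ x ∈ S ∧ x ∉ inSet f S := by
    simp only [exitSet, inSet, mem_ofPred_eq]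
    push Not
    rfl
  rw [h, mem_inSet_iff hx, Filter.not_eventually]

theorem exitSet_union_subset {f : E → E} (hf : ∀ x, ∃ a b γ, IsSolution f x a b γ)
    (S₁ S₂ : Set E) : exitSet f (S₁ ∪ S₂) ⊆
      (exitSet f S₁ ∩ (inSet f S₂)ᶜ) ∪ ((inSet f S₁)ᶜ ∩ exitSet f S₂) := by
  intro x hx
  simp only [mem_union, mem_inter_iff, mem_compl_iff, mem_inSet_iff (hf x),
    mem_exitSet_iff (hf x), not_or, Filter.not_eventually] at hx ⊢
  obtain ⟨hx1, hx2⟩ := hx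
  have h1 := hx2.mono fun t ht => ht.1
  have h2 := hx2.mono fun t ht => ht.2
  exact hx1.imp (fun h => ⟨⟨h, h1⟩, h2⟩) fun h => ⟨h1, h, h2⟩

theorem exitSet_union_of_isSemianalytic [CompleteSpace E] {f : E → E}
    (hf : AnalyticOnNhd ℝ f univ) {S₁ S₂ : Set E} (h₁ : IsSemianalytic S₁)
    (h₂ : IsSemianalytic S₂) : exitSet f (S₁ ∪ S₂) =
      (exitSet f S₁ ∩ (inSet f S₂)ᶜ) ∪ ((inSet f S₁)ᶜ ∩ exitSet f S₂) := by
  have hc : ContDiff ℝ 1 f := contDiff_iff_contDiffAt.2 fun x => (hf x (mem_univ x)).contDiffAt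
  have hsol := IsSolution.exists_of_contDiff hc
  refine (exitSet_union_subset hsol S₁ S₂).antisymm fun x hx => ?_
  -- "Frequently outside" becomes "eventually outside", so the two conditions can hold
  -- simultaneously.
  have hdich : ∀ S : Set E, IsSemianalytic S → (∃ᶠ t in 𝓝[>] 0, flow f t x ∉ S) →
      ∀ᶠ t in 𝓝[>] 0, flow f t x ∉ S := by
    intro S hS hfr
    obtain ⟨a, b, γ, hγ⟩ := hsol x
    have heq : ∀ᶠ t in 𝓝[>] 0, flow f t x = γ t :=
      (Eventually.filter_mono nhdsWithin_le_nhds (Ioo_mem_nhds hγ.1 hγ.2.1)).mono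
        fun t ht => hγ.flow_eq hc ht
    rcases hS.eventually_mem_or_notMem (hf x (mem_univ x)) hγ.2.2.1 hγ.eventually_hasDerivAt
      with hin | hout
    · obtain ⟨t, ht, ht1, ht2⟩ := (hfr.and_eventually (heq.and hin)).exists
      rw [ht1] at ht
      exact absurd ht2 ht
    · filter_upwards [heq, hout] with t ht ht' using ht ▸ ht'
  simp only [mem_union, mem_inter_iff, mem_compl_iff, mem_inSet_iff (hsol x),
    mem_exitSet_iff (hsol x), not_or, Filter.not_eventually] at hx ⊢
  rcases hx with ⟨⟨hx, h1⟩, h2⟩ | ⟨h1, hx, h2⟩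
  · exact ⟨Or.inl hx, ((hdich _ h₁ h1).and (hdich _ h₂ h2)).frequently⟩
  · exact ⟨Or.inr hx, ((hdich _ h₁ h1).and (hdich _ h₂ h2)).frequently⟩

end Flow

/-! ### Counterexample on the line -/

section Line

theorem frequently_nhdsGT_zero_of_dense {D : Set ℝ} (hD : Dense D) : ∃ᶠ t in 𝓝[>] 0, t ∈ D := by
  refine (frequently_nhdsWithin_iff.2 ?_)
  rw [frequently_iff]
  intro U hU
  obtain ⟨ε, hε, hεU⟩ := Metric.mem_nhds_iff.1 hU
  obtain ⟨t, htD, ht⟩ := hD.exists_between hε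
  refine ⟨t, hεU ?_, htD, ht.1⟩
  rw [Metric.mem_ball, dist_zero_right, Real.norm_of_nonneg ht.1.le]
  exact ht.2

theorem isSolution_unit_speed (x : EuclideanSpace ℝ (Fin 1)) :
    IsSolution (fun _ => !₂[(1 : ℝ)]) x (-1) 1 fun t => x + t • !₂[(1 : ℝ)] := by
  refine ⟨by norm_num, by norm_num, by simp, fun t _ => ?_⟩
  simpa using ((hasDerivAt_id t).smul_const (!₂[(1 : ℝ)])).const_add x

/-- For the unit speed flow on the line, the set of rational points and its complement violate the
inclusion. -/
theorem exists_not_subset_exitSet_union : ∃ S₁ S₂ : Set (EuclideanSpace ℝ (Fin 1)),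
    ¬ ((exitSet (fun _ => !₂[(1 : ℝ)]) S₁ ∩ (inSet (fun _ => !₂[(1 : ℝ)]) S₂)ᶜ) ∪
        ((inSet (fun _ => !₂[(1 : ℝ)]) S₁)ᶜ ∩ exitSet (fun _ => !₂[(1 : ℝ)]) S₂) ⊆
      exitSet (fun _ => !₂[(1 : ℝ)]) (S₁ ∪ S₂)) := by
  set S : Set (EuclideanSpace ℝ (Fin 1)) := {y | ¬ Irrational (y 0)} with hS
  refine ⟨S, Sᶜ, fun hsub => ?_⟩
  have hsol := isSolution_unit_speed 0
  have hex : ∃ a b γ, IsSolution (fun _ => !₂[(1 : ℝ)]) (0 : EuclideanSpace ℝ (Fin 1)) a b γ :=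
    ⟨_, _, _, hsol⟩
  have hflow : ∀ᶠ t in 𝓝[>] (0 : ℝ), flow (fun _ => !₂[(1 : ℝ)])
      t (0 : EuclideanSpace ℝ (Fin 1)) 0 = t := by
    filter_upwards [Ioo_mem_nhdsGT one_pos] with t ht
    rw [hsol.flow_eq contDiff_const ⟨by linarith [ht.1], ht.2⟩]
    simp
  -- Both rational and irrational times accumulate at `0`, so the origin satisfies the right-hand
  -- condition; yet the union is everything and cannot be left.
  have hmem : (0 : EuclideanSpace ℝ (Fin 1)) ∈ exitSet (fun _ => !₂[(1 : ℝ)]) (S ∪ Sᶜ) := by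
    refine hsub (Or.inl ⟨(mem_exitSet_iff hex).2 ⟨by simp [hS], ?_⟩, ?_⟩)
    · refine ((frequently_nhdsGT_zero_of_dense dense_irrational).and_eventually hflow).mono ?_
      rintro t ⟨ht, ht'⟩
      simpa [hS, ht'] using ht
    · rw [mem_compl_iff, mem_inSet_iff hex, Filter.not_eventually]
      refine ((frequently_nhdsGT_zero_of_dense
        Rat.denseRange_cast).and_eventually hflow).mono ?_
      rintro t ⟨⟨q, rfl⟩, ht'⟩
      simp [hS, ht']
  obtain ⟨-, hfr⟩ := (mem_exitSet_iff hex).1 hmem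
  rw [union_compl_self] at hfr
  obtain ⟨t, ht⟩ := hfr.exists
  exact ht (mem_univ _)

end Line

theorem mainTheorem7 :
    -- equality for semi-analytic sets and real analytic systems
    (∀ (n : ℕ) (f : EuclideanSpace ℝ (Fin n) → EuclideanSpace ℝ (Fin n)),
      AnalyticOnNhd ℝ f Set.univ →
      ∀ S₁ S₂ : Set (EuclideanSpace ℝ (Fin n)), IsSemianalytic S₁ → IsSemianalytic S₂ →
        exitSet f (S₁ ∪ S₂) =
          (exitSet f S₁ ∩ (inSet f S₂)ᶜ) ∪ ((inSet f S₁)ᶜ ∩ exitSet f S₂)) ∧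
    -- inclusion for arbitrary sets and arbitrary systems with unique solutions
    (∀ (n : ℕ) (f : EuclideanSpace ℝ (Fin n) → EuclideanSpace ℝ (Fin n)),
      Continuous f → HasUniqueSolutions f →
      ∀ S₁ S₂ : Set (EuclideanSpace ℝ (Fin n)),
        exitSet f (S₁ ∪ S₂) ⊆
          (exitSet f S₁ ∩ (inSet f S₂)ᶜ) ∪ ((inSet f S₁)ᶜ ∩ exitSet f S₂)) ∧
    -- the reverse inclusion fails for arbitrary sets, already for the system `x' = 1` on the line
    (∃ S₁ S₂ : Set (EuclideanSpace ℝ (Fin 1)),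
      ¬ ((exitSet (fun _ => !₂[(1 : ℝ)]) S₁ ∩ (inSet (fun _ => !₂[(1 : ℝ)]) S₂)ᶜ) ∪
            ((inSet (fun _ => !₂[(1 : ℝ)]) S₁)ᶜ ∩ exitSet (fun _ => !₂[(1 : ℝ)]) S₂) ⊆
          exitSet (fun _ => !₂[(1 : ℝ)]) (S₁ ∪ S₂))) := by
  exact ⟨fun _ _ hf _ _ h₁ h₂ => exitSet_union_of_isSemianalytic hf h₁ h₂,
    fun _ _ _ hf S₁ S₂ => exitSet_union_subset (fun x => (hf x).1) S₁ S₂,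
    exists_not_subset_exitSet_union⟩
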